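/- For positive integers $n,m,p$ consider the system $\dot x=Ax+Bu$, $y=Cx$ with $A\in\mathbb R^{n\times n}$, $B\in\mathbb R^{n\times m}$, $C\in\mathbb R^{p\times n}$, a linear subspace $\mathcal S\subseteq\mathbb R^{m\times p}$, weights $R_1\in\mathbb R^{n\times n}$, $R_{12}\in\mathbb R^{n\times m}$, $R_2\in\mathbb R^{m\times m}$, and the covariance matrix $D_0\in\mathbb R^{n\times n}$ of the random zero-mean initial state. Let $\mathcal M\subseteq\mathbb R^{m\times p}$ be the set of all $K$ such that every eigenvalue of $A-BKC$ has negative real part, and for $K\in\mathcal M$ put $J(K)=\operatorname{trace}(P(K)D_0)$ with $$P(K)=\int_0^\infty e^{(A-BKC)^\top t}\bigl[R_1-R_{12}KC-C^\top K^\top R_{12}^\top+C^\top K^\top R_2KC\bigr]e^{(A-BKC)t}\,dt .$$ The optimal decentralized control problem is $(P_1)$: minimize $J(K)$ over $K\in\mathcal M\cap\mathcal S$. A penalty function for $\mathcal S$ is a continuous function $h:\mathbb R^{m\times p}\to[0,\infty)$ with $h(K)=0$ if and only if $K\in\mathcal S$; the penalized problem with constant $c>0$ is $(P_1')$: minimize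 $J(K)+c\,h(K)$ over $K\in\mathcal M$. There are constants $a>0$ and $r>1$ such that for every state dimension $n\ge 1$ there are $m,p\in\{1,\dots,n\}$ and $(A,B,C,\mathcal S)$ as above, with $C$ of full row rank, for which the following holds for all weights such that $\begin{bmatrix}R_1&R_{12}\\R_{12}^\top&R_2\end{bmatrix}$ is positive definite and every positive definite $D_0$: the problem $(P_1)$ has at least $a\,r^n$ local minima, and for every penalty function $h$ for $\mathcal S$ there is $c_0>0$ such that for every $c\ge c_0$ the problem $(P_1')$ has at least $a\,r^n$ local minima. -/

import Mathlib

/-- The data of a linear time-invariant system `x' = A x + B u`, `y = C x` with `n` states, `m` inputs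
and `p` outputs, together with the linear subspace `S` of admissible (decentralized) static
output-feedback gains `K`, the control law being `u = -K y`. -/
structure ODCSystem (n m p : ℕ) where
  A : Matrix (Fin n) (Fin n) ℝ
  B : Matrix (Fin n) (Fin m) ℝ
  C : Matrix (Fin p) (Fin n) ℝ
  S : Submodule ℝ (Matrix (Fin m) (Fin p) ℝ)

/-- The data of the quadratic cost: the weights `R₁`, `R₁₂`, `R₂` and the covariance `D₀` of the
zero-mean random initial state. -/
structure ODCCost (n m : ℕ) where
  R₁ : Matrix (Fin n) (Fin n) ℝ
  R₁₂ : Matrix (Fin n) (Fin m) ℝ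
  R₂ : Matrix (Fin m) (Fin m) ℝ
  D₀ : Matrix (Fin n) (Fin n) ℝ

/-- The block weight matrix `[R₁, R₁₂; R₁₂ᵀ, R₂]`. -/
def ODCCost.weight {n m : ℕ} (w : ODCCost n m) : Matrix (Fin n ⊕ Fin m) (Fin n ⊕ Fin m) ℝ :=
  Matrix.fromBlocks w.R₁ w.R₁₂ w.R₁₂.transpose w.R₂

/-- A real square matrix is Hurwitz if all its complex eigenvalues have negative real part. -/
def IsHurwitz {n : ℕ} (M : Matrix (Fin n) (Fin n) ℝ) : Prop :=
  ∀ z ∈ spectrum ℂ (M.map (fun x : ℝ => (x : ℂ))), z.re < 0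

namespace ODCSystem

variable {n m p : ℕ}

/-- The closed-loop matrix `A - B K C`. -/
def closedLoop (G : ODCSystem n m p) (K : Matrix (Fin m) (Fin p) ℝ) :
    Matrix (Fin n) (Fin n) ℝ :=
  G.A - G.B * K * G.C

/-- The set of stabilizing gains (with no structural constraint). -/
def stabilizing (G : ODCSystem n m p) : Set (Matrix (Fin m) (Fin p) ℝ) :=
  {K | IsHurwitz (G.closedLoop K)}

/-- The closed-loop weight `R₁ - R₁₂ K C - Cᵀ Kᵀ R₁₂ᵀ + Cᵀ Kᵀ R₂ K C`. -/
def closedLoopWeight (G : ODCSystem n m p) (w : ODCCost n m) (K : Matrix (Fin m) (Fin p) ℝ) :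
    Matrix (Fin n) (Fin n) ℝ :=
  w.R₁ - w.R₁₂ * K * G.C - G.C.transpose * K.transpose * w.R₁₂.transpose
    + G.C.transpose * K.transpose * w.R₂ * K * G.C

/-- The closed-loop observability Gramian: the entrywise integral over `t ∈ (0, ∞)` of
`exp (t (A - B K C))ᵀ (closedLoopWeight) exp (t (A - B K C))`. It is only used for stabilizing `K`,
for which the integral converges. -/
noncomputable def gramian (G : ODCSystem n m p) (w : ODCCost n m)
    (K : Matrix (Fin m) (Fin p) ℝ) : Matrix (Fin n) (Fin n) ℝ :=
  Matrix.of fun i j => ∫ t in Set.Ioi (0 : ℝ),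
    (NormedSpace.exp (t • (G.closedLoop K).transpose) * G.closedLoopWeight w K
      * NormedSpace.exp (t • G.closedLoop K)) i j

/-- The objective function `J(K) = trace (P(K) D₀)`. -/
noncomputable def cost (G : ODCSystem n m p) (w : ODCCost n m)
    (K : Matrix (Fin m) (Fin p) ℝ) : ℝ :=
  (G.gramian w K * w.D₀).trace

/-- `K` is a local minimum of the constrained problem: minimize `J(K)` over stabilizing `K ∈ S`. -/
def IsConstrainedLocalMin (G : ODCSystem n m p) (w : ODCCost n m)
    (K : Matrix (Fin m) (Fin p) ℝ) : Prop :=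
  K ∈ G.stabilizing ∩ G.S ∧ IsLocalMinOn (G.cost w) (G.stabilizing ∩ G.S) K

/-- A penalty function for the constraint `K ∈ S`: continuous, nonnegative, and zero exactly
on `S`. -/
structure IsPenalty (G : ODCSystem n m p) (h : Matrix (Fin m) (Fin p) ℝ → ℝ) : Prop where
  continuous : Continuous h
  nonneg : ∀ K, 0 ≤ h K
  eq_zero_iff : ∀ K, h K = 0 ↔ K ∈ G.S

/-- `K` is a local minimum of the penalized problem: minimize `J(K) + c h(K)` over all
stabilizing `K`. -/
def IsPenalizedLocalMin (G : ODCSystem n m p) (w : ODCCost n m)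
    (h : Matrix (Fin m) (Fin p) ℝ → ℝ) (c : ℝ) (K : Matrix (Fin m) (Fin p) ℝ) : Prop :=
  K ∈ G.stabilizing ∧ IsLocalMinOn (fun L => G.cost w L + c * h L) G.stabilizing K

end ODCSystem

/-! The plants are `n / 2` decoupled blocks, and feedback with a skew gain `k` gives the closed loop
`[-1, 2 - k; 2 + k, -1]` with eigenvalues `-1 ± √(4 - k²)`. At `k = 0` one of them is `1`, while `k
= ±2` is stabilizing. Hence no stabilizing gain in `S` has a vanishing `k`, and the sign patterns of
the `k`'s split the feasible set into `2 ^ (n / 2)` nonempty pieces, cut out by disjoint open sets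
of matrices.

Each piece contains a local minimum because the cost is coercive, whatever the positive definite
weights. Factoring the weight as `Vᵀ V` and `D₀` as `L Lᵀ` turns the cost into the energy `∫ ‖V [I;
-K C] exp(t M) L‖² dt` with `M = A - B K C`. As an extended-valued integral (`extCost`) it is
defined for every gain, is lower semicontinuous by Fatou, and is finite exactly at stabilizing gains
(`stabilizing_iff_extCost_lt_top`). Its finite sublevel sets are compact
(`isCompact_setOf_extCost_le`); boundedness comes from `sq_norm_gain_le`, since a large gain costs
much control energy before the state has time to move.

In the penalized problem the pieces no longer cover the stabilizing set. But on the compact part of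
a sublevel set outside all pieces the penalty is bounded below by a positive constant, so a large
`c` keeps the minimizers inside the pieces (`exists_penalized_min_of_isOpen_cover`). -/

/-! ### Exponential decay and the Hurwitz property -/

section MatrixExponential

open Matrix MeasureTheory Filter Topology
open scoped Matrix.Norms.Frobenius

/-- The matrix exponential acts on (blocks of) eigenvectors through the exponential of the
eigenvalue. -/
theorem exp_mul_of_mul_eq_smul {ι κ : Type*} [Fintype ι] [DecidableEq ι] [Fintype κ]
    {M : Matrix ι ι ℂ} {V : Matrix ι κ ℂ} {z : ℂ} (h : M * V = z • V) :
    NormedSpace.exp M * V = Complex.exp z • V := by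
  have hpow : ∀ k : ℕ, M ^ k * V = z ^ k • V := by
    intro k
    induction k with
    | zero => simp
    | succ k ih => rw [pow_succ, Matrix.mul_assoc, h, Matrix.mul_smul, ih, smul_smul, pow_succ']
  have h₁ : HasSum (fun k : ℕ => ((k.factorial : ℂ)⁻¹ • M ^ k) * V) (NormedSpace.exp M * V) :=
    (NormedSpace.exp_series_hasSum_exp' (𝕂 := ℂ) M).map
      (⟨⟨fun X : Matrix ι ι ℂ => X * V, Matrix.zero_mul V⟩, fun X Y => Matrix.add_mul X Y V⟩ :
        Matrix ι ι ℂ →+ Matrix ι κ ℂ) (continuous_id.matrix_mul continuous_const)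
  have h₂ : HasSum (fun k : ℕ => ((k.factorial : ℂ)⁻¹ • z ^ k) • V) (NormedSpace.exp z • V) :=
    (NormedSpace.exp_series_hasSum_exp' (𝕂 := ℂ) z).smul_const V
  rw [Complex.exp_eq_exp_ℂ]
  refine h₁.unique ?_
  convert h₂ using 2 with k
  rw [Matrix.smul_mul, hpow, smul_smul, smul_eq_mul]

/-- A matrix whose spectrum contains `z` has an eigenvector for `z`, here as a one-column matrix. -/
theorem exists_eigencolumn {ι : Type*} [Fintype ι] [DecidableEq ι] {M : Matrix ι ι ℂ} {z : ℂ}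
    (hz : z ∈ spectrum ℂ M) : ∃ V : Matrix ι (Fin 1) ℂ, V ≠ 0 ∧ M * V = z • V := by
  rw [← Matrix.spectrum_toLin', ← Module.End.hasEigenvalue_iff_mem_spectrum] at hz
  obtain ⟨v, hv⟩ := hz.exists_hasEigenvector
  refine ⟨replicateCol (Fin 1) v, fun h => hv.2 ?_, ?_⟩
  · ext i
    exact congrFun (congrFun h i) 0
  · have := hv.apply_eq_smul
    rw [Matrix.toLin'_apply] at this
    rw [← Matrix.replicateCol_mulVec, this, Matrix.replicateCol_smul]

theorem mem_spectrum_of_eigencolumn {ι : Type*} [Fintype ι] [DecidableEq ι] {M : Matrix ι ι ℂ}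
    {z : ℂ} {v : ι → ℂ} (hv : v ≠ 0) (h : M *ᵥ v = z • v) : z ∈ spectrum ℂ M := by
  rw [← Matrix.spectrum_toLin', ← Module.End.hasEigenvalue_iff_mem_spectrum]
  exact Module.End.hasEigenvalue_of_hasEigenvector (x := v)
    (Module.End.hasEigenvector_iff.mpr
      ⟨Module.End.mem_eigenspace_iff.mpr (by rw [Matrix.toLin'_apply, h]), hv⟩)

/-- The eigenvalues of `exp M` are exponentials of eigenvalues of `M`. -/
theorem exists_exp_eq_of_mem_spectrum_exp {ι : Type*} [Fintype ι] [DecidableEq ι]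
    {M : Matrix ι ι ℂ} {μ : ℂ} (hμ : μ ∈ spectrum ℂ (NormedSpace.exp M)) :
    ∃ z ∈ spectrum ℂ M, Complex.exp z = μ := by
  rw [← Matrix.spectrum_toLin', ← Module.End.hasEigenvalue_iff_mem_spectrum] at hμ
  set E := Module.End.eigenspace (Matrix.toLin' (NormedSpace.exp M)) μ with hE
  have hcomm : Commute M (NormedSpace.exp M) := (Commute.refl M).exp_right
  -- `M` commutes with `exp M`, so it preserves the eigenspace `E`; an eigenvector of `M` inside `E`
  -- ties the two eigenvalues together.
  have hmaps : ∀ v ∈ E, Matrix.toLin' M v ∈ E := by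
    intro v hv
    rw [hE, Module.End.mem_eigenspace_iff, Matrix.toLin'_apply] at hv ⊢
    rw [Matrix.toLin'_apply, Matrix.mulVec_mulVec, ← hcomm.eq, ← Matrix.mulVec_mulVec, hv,
      Matrix.mulVec_smul]
  have : Nontrivial E := Submodule.nontrivial_iff_ne_bot.mpr hμ
  obtain ⟨z, hz⟩ := Module.End.exists_eigenvalue ((Matrix.toLin' M).restrict hmaps)
  obtain ⟨⟨v, hvE⟩, hv⟩ := hz.exists_hasEigenvector
  have hv0 : v ≠ 0 := fun h => hv.2 (by ext1; exact h)
  have hMv : M *ᵥ v = z • v := by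
    have := congrArg Subtype.val hv.apply_eq_smul
    simpa [Matrix.toLin'_apply] using this
  refine ⟨z, mem_spectrum_of_eigencolumn hv0 hMv, ?_⟩
  have hexp : NormedSpace.exp M * replicateCol (Fin 1) v
      = Complex.exp z • replicateCol (Fin 1) v :=
    exp_mul_of_mul_eq_smul (by rw [← Matrix.replicateCol_mulVec, hMv, Matrix.replicateCol_smul])
  rw [hE, Module.End.mem_eigenspace_iff, Matrix.toLin'_apply] at hvE
  rw [← Matrix.replicateCol_mulVec, hvE, ← Matrix.replicateCol_smul] at hexp
  obtain ⟨i, hi⟩ := Function.ne_iff.mp hv0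
  have := congrFun (congrFun hexp i) 0
  simp only [replicateCol_apply, Pi.smul_apply, smul_eq_mul] at this
  exact (mul_right_cancel₀ hi this).symm

theorem norm_map_ofReal {ι κ : Type*} [Fintype ι] [Fintype κ] (M : Matrix ι κ ℝ) :
    ‖M.map (fun x : ℝ => (x : ℂ))‖ = ‖M‖ :=
  frobenius_norm_map_eq M _ fun a => by simp

theorem exp_map_ofReal {ι : Type*} [Fintype ι] [DecidableEq ι] (M : Matrix ι ι ℝ) :
    (NormedSpace.exp M).map (fun x : ℝ => (x : ℂ))
      = NormedSpace.exp (M.map (fun x : ℝ => (x : ℂ))) := by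
  refine NormedSpace.map_exp (Complex.ofRealHom.mapMatrix : Matrix ι ι ℝ →+* Matrix ι ι ℂ) ?_ M
  exact continuous_id.matrix_map Complex.continuous_ofReal

theorem continuous_exp_smul {ι : Type*} [Fintype ι] [DecidableEq ι] (M : Matrix ι ι ℝ) :
    Continuous fun t : ℝ => NormedSpace.exp (t • M) :=
  NormedSpace.exp_continuous.comp (continuous_id.smul continuous_const)

theorem exp_add_smul {ι : Type*} [Fintype ι] [DecidableEq ι] (M : Matrix ι ι ℝ) (s t : ℝ) :
    NormedSpace.exp ((s + t) • M) = NormedSpace.exp (s • M) * NormedSpace.exp (t • M) := by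
  rw [add_smul, Matrix.exp_add_of_commute]
  exact ((Commute.refl M).smul_left s).smul_right t

/-- Some power of the exponential of a Hurwitz matrix is a contraction. -/
theorem IsHurwitz.exists_norm_exp_lt_one {n : ℕ} {M : Matrix (Fin n) (Fin n) ℝ}
    (hM : IsHurwitz M) : ∃ N : ℕ, 0 < N ∧ ‖NormedSpace.exp ((N : ℝ) • M)‖ < 1 := by
  rcases isEmpty_or_nonempty (Fin n) with hn | hn
  · exact ⟨1, one_pos, by rw [Subsingleton.elim (NormedSpace.exp _) 0, norm_zero]; exact one_pos⟩
  set b := NormedSpace.exp (M.map (fun x : ℝ => (x : ℂ))) with hb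
  have hρ : spectralRadius ℂ b < 1 := by
    have := spectrum.spectralRadius_lt_of_forall_lt b (r := 1) fun μ hμ => by
      obtain ⟨z, hz, rfl⟩ := exists_exp_eq_of_mem_spectrum_exp hμ
      rw [← NNReal.coe_lt_coe, coe_nnnorm, Complex.norm_exp]
      exact Real.exp_lt_one_iff.mpr (hM z hz)
    simpa using this
  -- Gelfand's formula: spectral radius below `1` forces some power to have norm below `1`.
  have hev := (spectrum.pow_nnnorm_pow_one_div_tendsto_nhds_spectralRadius b).eventually
    (gt_mem_nhds hρ)
  obtain ⟨N, hN, hpos⟩ := (hev.and (eventually_gt_atTop 0)).exists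
  refine ⟨N, hpos, ?_⟩
  have h1 : (‖b ^ N‖₊ : ENNReal) < 1 := by
    by_contra! hc
    exact absurd hN (not_lt.mpr (ENNReal.one_le_rpow hc (by positivity)))
  have h2 : ‖b ^ N‖ < 1 := by
    rw [← coe_nnnorm]; exact_mod_cast h1
  rwa [hb, ← Matrix.exp_nsmul, ← Matrix.map_smul _ N (fun a => by simp), ← exp_map_ofReal,
    norm_map_ofReal, ← Nat.cast_smul_eq_nsmul ℝ] at h2

/-- The exponential of a Hurwitz matrix decays exponentially. -/
theorem IsHurwitz.exists_norm_exp_le {n : ℕ} {M : Matrix (Fin n) (Fin n) ℝ}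
    (hM : IsHurwitz M) : ∃ C δ : ℝ, 0 < δ ∧
      ∀ t : ℝ, 0 ≤ t → ‖NormedSpace.exp (t • M)‖ ≤ C * Real.exp (-δ * t) := by
  obtain ⟨N, hN, hlt⟩ := hM.exists_norm_exp_lt_one
  have hN' : (0 : ℝ) < N := Nat.cast_pos.mpr hN
  -- The maximum with `1 / 2` keeps `q` positive, so that `log q` is usable even if the norm is
  -- tiny.
  set q := max ‖NormedSpace.exp ((N : ℝ) • M)‖ (1 / 2) with hq
  have hq0 : 0 < q := lt_max_of_lt_right (by norm_num)
  have hq1 : q < 1 := max_lt hlt (by norm_num)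
  set δ := -Real.log q / N with hδ
  have hδ0 : 0 < δ := div_pos (neg_pos.mpr (Real.log_neg hq0 hq1)) hN'
  have hδN : Real.exp (δ * N) = q⁻¹ := by
    rw [hδ, div_mul_cancel₀ _ hN'.ne', Real.exp_neg, Real.exp_log hq0]
  set f : ℝ → ℝ := fun t => ‖NormedSpace.exp (t • M)‖ * Real.exp (δ * t) with hf
  have hfc : Continuous f := (continuous_exp_smul M).norm.mul
    (Real.continuous_exp.comp (continuous_const.mul continuous_id))
  obtain ⟨C, hC⟩ := (isCompact_Icc (a := (0 : ℝ)) (b := N)).bddAbove_image hfc.continuousOn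
  -- Since `exp (δ N) = q⁻¹`, the gain of the weight over one period cancels the contraction; a
  -- bound on `[0, N]` then propagates to all `t ≥ 0`.
  have hstep : ∀ t, f (t + N) ≤ f t := by
    intro t
    have h1 : ‖NormedSpace.exp ((t + N) • M)‖ ≤ ‖NormedSpace.exp (t • M)‖ * q := by
      rw [exp_add_smul]
      exact (norm_mul_le _ _).trans (by gcongr; exact le_max_left _ _)
    calc f (t + N) ≤ (‖NormedSpace.exp (t • M)‖ * q) * Real.exp (δ * (t + N)) := by
          simp only [hf]; gcongr
      _ = f t := by
          simp only [hf]
          rw [mul_add, Real.exp_add, hδN]; field_simp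
  have hbound : ∀ k : ℕ, ∀ t : ℝ, 0 ≤ t → t ≤ (k + 1) * N → f t ≤ C := by
    intro k
    induction k with
    | zero => exact fun t h0 h1 => hC ⟨t, ⟨h0, by simpa using h1⟩, rfl⟩
    | succ k ih =>
      intro t h0 h1
      rcases le_total t N with h | h
      · exact hC ⟨t, ⟨h0, h⟩, rfl⟩
      · have := hstep (t - N)
        rw [sub_add_cancel] at this
        refine this.trans (ih _ (sub_nonneg.mpr h) ?_)
        push_cast at h1
        linarith
  refine ⟨C, δ, hδ0, fun t ht => ?_⟩
  obtain ⟨k, hk⟩ := exists_nat_ge (t / N)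
  have hft := hbound k t ht (by rw [div_le_iff₀ hN'] at hk; nlinarith)
  rw [neg_mul, Real.exp_neg, ← div_eq_mul_inv, le_div_iff₀ (Real.exp_pos _)]
  exact hft

/-- If the flow of `M` is square integrable, then `M` is Hurwitz. -/
theorem isHurwitz_of_lintegral_exp_ne_top {n : ℕ} {M : Matrix (Fin n) (Fin n) ℝ}
    (h : ∫⁻ t in Set.Ioi (0 : ℝ), ENNReal.ofReal (‖NormedSpace.exp (t • M)‖ ^ 2) ≠ ⊤) :
    IsHurwitz M := by
  intro z hz
  by_contra! hre
  obtain ⟨V, hV0, hV⟩ := exists_eigencolumn hz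
  have hge : ∀ t : ℝ, 0 ≤ t → 1 ≤ ‖NormedSpace.exp (t • M)‖ := by
    intro t ht
    have hmul : (t • M).map (fun x : ℝ => (x : ℂ)) * V = ((t : ℂ) * z) • V := by
      have : (t • M).map (fun x : ℝ => (x : ℂ)) = (t : ℂ) • M.map (fun x : ℝ => (x : ℂ)) := by
        ext; simp
      rw [this, Matrix.smul_mul, hV, smul_smul]
    have hexp := exp_mul_of_mul_eq_smul hmul
    have hnorm := frobenius_norm_mul (NormedSpace.exp ((t • M).map (fun x : ℝ => (x : ℂ)))) V
    rw [hexp, ← exp_map_ofReal, norm_map_ofReal, norm_smul, Complex.norm_exp] at hnorm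
    refine le_trans ?_ (le_of_mul_le_mul_right hnorm (norm_pos_iff.mpr hV0))
    rw [Complex.re_ofReal_mul]
    exact Real.one_le_exp (mul_nonneg ht hre)
  apply h
  rw [eq_top_iff]
  calc (⊤ : ENNReal) = ∫⁻ _ in Set.Ioi (0 : ℝ), 1 := by simp
    _ ≤ _ := setLIntegral_mono' measurableSet_Ioi fun t ht => by
        rw [ENNReal.one_le_ofReal]
        exact one_le_pow₀ (hge t (le_of_lt ht))

end MatrixExponential
-- The cost as a coercive extended-valued energy
section CostAnalysis

open Matrix MeasureTheory Filter Topology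
open scoped Matrix.Norms.Frobenius

theorem sq_norm_eq_trace {ι κ : Type*} [Fintype ι] [Fintype κ] (Y : Matrix ι κ ℝ) :
    ‖Y‖ ^ 2 = (Yᵀ * Y).trace := by
  rw [frobenius_norm_def, ← Real.sqrt_eq_rpow, Real.sq_sqrt (by positivity)]
  simp only [Matrix.trace, Matrix.diag_apply, Matrix.mul_apply, Matrix.transpose_apply]
  rw [Finset.sum_comm]
  simp [sq]

theorem abs_entry_le_frobenius_norm {ι κ : Type*} [Fintype ι] [Fintype κ] (M : Matrix ι κ ℝ)
    (i : ι) (j : κ) : |M i j| ≤ ‖M‖ := by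
  refine abs_le_of_sq_le_sq ?_ (norm_nonneg _)
  rw [frobenius_norm_def, ← Real.sqrt_eq_rpow, Real.sq_sqrt (by positivity)]
  calc M i j ^ 2 = ‖M i j‖ ^ (2 : ℕ) := by simp
    _ ≤ ∑ j, ‖M i j‖ ^ (2 : ℕ) :=
      Finset.single_le_sum (f := fun j => ‖M i j‖ ^ 2) (fun _ _ => by positivity)
        (Finset.mem_univ j)
    _ ≤ ∑ i, ∑ j, ‖M i j‖ ^ (2 : ℕ) :=
      Finset.single_le_sum (f := fun i => ∑ j, ‖M i j‖ ^ 2) (fun _ _ => by positivity)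
        (Finset.mem_univ i)
    _ = _ := by simp

open scoped MatrixOrder in
theorem Matrix.PosDef.exists_transpose_mul_self {ι : Type*} [Fintype ι] [DecidableEq ι]
    {W : Matrix ι ι ℝ} (hW : W.PosDef) : ∃ V V' : Matrix ι ι ℝ, V' * V = 1 ∧ W = Vᵀ * V := by
  obtain ⟨V, hV, rfl⟩ := CStarAlgebra.isStrictlyPositive_iff_eq_star_mul_self.mp
    hW.isStrictlyPositive
  exact ⟨V, V⁻¹, Matrix.nonsing_inv_mul _ ((Matrix.isUnit_iff_isUnit_det _).mp hV), rfl⟩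

/-- Parametric integrals of nonnegative continuous functions are lower semicontinuous. -/
theorem lowerSemicontinuous_lintegral_of_continuous {X : Type*} [TopologicalSpace X]
    [FirstCountableTopology X] {μ : Measure ℝ} {F : X → ℝ → ENNReal}
    (hF : Continuous (Function.uncurry F)) : LowerSemicontinuous fun x => ∫⁻ t, F x t ∂μ := by
  intro x
  refine lowerSemicontinuousAt_iff_le_liminf.mpr ?_
  have hlim : ∀ t, F x t = liminf (fun y => F y t) (𝓝 x) := fun t =>
    (Tendsto.liminf_eq (hF.comp (continuous_id.prodMk continuous_const)).continuousAt).symm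
  calc ∫⁻ t, F x t ∂μ = ∫⁻ t, liminf (fun y => F y t) (𝓝 x) ∂μ := by simp_rw [← hlim]
    _ ≤ _ := lintegral_liminf_le fun y =>
        (hF.comp (continuous_const.prodMk continuous_id)).measurable

/-- A static gain is controlled by the energy of the resulting closed-loop trajectories and of the
corresponding inputs. -/
theorem sq_norm_gain_le {n m : ℕ} {A M : Matrix (Fin n) (Fin n) ℝ} {B : Matrix (Fin n) (Fin m) ℝ}
    {Z : Matrix (Fin m) (Fin n) ℝ} (hM : M = A - B * Z) {g : ℝ → ℝ} {κ a : ℝ} (hκ : 0 ≤ κ)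
    (hg : IntegrableOn g (Set.Ioi 0)) (hg0 : ∀ t, 0 ≤ g t) (ha : ∫ t in Set.Ioi 0, g t ≤ a)
    (h₁ : ∀ t, ‖NormedSpace.exp (t • M)‖ ^ 2 ≤ κ * g t)
    (h₂ : ∀ t, ‖Z * NormedSpace.exp (t • M)‖ ^ 2 ≤ κ * g t) :
    ‖Z‖ ^ 2 ≤ 16 * ((‖A‖ + ‖B‖) ^ 2 * κ * a + 1) * κ * a := by
  have ha0 : 0 ≤ a := (setIntegral_nonneg measurableSet_Ioi fun t _ => hg0 t).trans ha
  set b := (‖A‖ + ‖B‖) ^ 2 * κ with hb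
  have hb0 : 0 ≤ b := by positivity
  set β := b * a + 1 with hβ
  have hβ0 : 0 < β := by positivity
  set E : ℝ → Matrix (Fin n) (Fin n) ℝ := fun t => NormedSpace.exp (t • M) with hE
  have hderiv : ∀ t, HasDerivAt E (M * E t) t := fun t => hasDerivAt_exp_smul_const' M t
  have hEc : Continuous E := continuous_exp_smul M
  have hMEc : Continuous fun t => M * E t := continuous_const.mul hEc
  have hME : ∀ t, ‖M * E t‖ ^ 2 ≤ b * g t := by
    intro t
    have e1 : ‖M * E t‖ ≤ ‖A‖ * ‖E t‖ + ‖B‖ * ‖Z * E t‖ := by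
      rw [hM, Matrix.sub_mul, Matrix.mul_assoc]
      exact (norm_sub_le _ _).trans (add_le_add (norm_mul_le _ _) (frobenius_norm_mul _ _))
    have hs : Real.sqrt (κ * g t) ^ 2 = κ * g t := Real.sq_sqrt (mul_nonneg hκ (hg0 t))
    have e2 : ‖E t‖ ≤ Real.sqrt (κ * g t) := Real.le_sqrt_of_sq_le (h₁ t)
    have e3 : ‖Z * E t‖ ≤ Real.sqrt (κ * g t) := Real.le_sqrt_of_sq_le (h₂ t)
    have e4 : ‖M * E t‖ ≤ (‖A‖ + ‖B‖) * Real.sqrt (κ * g t) := by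
      rw [add_mul]
      exact e1.trans (by gcongr)
    calc ‖M * E t‖ ^ 2 ≤ ((‖A‖ + ‖B‖) * Real.sqrt (κ * g t)) ^ 2 := by gcongr
      _ = b * g t := by rw [mul_pow, hs, hb, mul_assoc]
  have hIoc : ∀ t, Set.Ioc (0 : ℝ) t ⊆ Set.Ioi 0 := fun t s hs => hs.1
  have hg_le : ∀ t, ∫ s in Set.Ioc 0 t, g s ≤ a := fun t =>
    (setIntegral_mono_set hg (ae_of_all _ hg0) (hIoc t).eventuallyLE).trans ha
  -- Short enough that `t₀ (b a + β) ≤ 1 / 2`, which keeps the flow within `1 / 2` of the identity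
  -- on `[0, t₀]`.
  set t₀ := 1 / (4 * β) with ht₀
  have ht₀0 : 0 < t₀ := by positivity
  have hclose : ∀ t, 0 ≤ t → t ≤ t₀ → ‖E t - 1‖ ≤ 1 / 2 := by
    intro t h0 h1
    have hftc : ∫ s in (0 : ℝ)..t, M * E s = E t - 1 := by
      rw [intervalIntegral.integral_eq_sub_of_hasDerivAt (fun s _ => hderiv s)
        (hMEc.intervalIntegrable _ _)]
      simp [hE]
    -- AM-GM: `x ≤ t₀ x² + 1 / (4 t₀)`, and `1 / (4 t₀) = β`.
    have hpt : ∀ s, ‖M * E s‖ ≤ t₀ * b * g s + β := by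
      intro s
      have h4 : 4 * β * t₀ = 1 := by rw [ht₀]; field_simp
      have := mul_le_mul_of_nonneg_left (hME s) ht₀0.le
      nlinarith [sq_nonneg (t₀ * ‖M * E s‖ - 1 / 2)]
    have hgi : IntegrableOn g (Set.Ioc 0 t) := hg.mono_set (hIoc t)
    calc ‖E t - 1‖ ≤ ∫ s in (0 : ℝ)..t, ‖M * E s‖ := by
          rw [← hftc]; exact intervalIntegral.norm_integral_le_integral_norm h0
      _ = ∫ s in Set.Ioc 0 t, ‖M * E s‖ := intervalIntegral.integral_of_le h0
      _ ≤ ∫ s in Set.Ioc 0 t, (t₀ * b * g s + β) := by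
          refine setIntegral_mono_on hMEc.norm.integrableOn_Ioc
            ((hgi.const_mul _).add (by simp)) measurableSet_Ioc fun s _ => hpt s
      _ = t₀ * b * (∫ s in Set.Ioc 0 t, g s) + t * β := by
          rw [integral_add (hgi.const_mul _) (by simp), integral_const_mul]
          simp [h0]
      _ ≤ t₀ * b * a + t₀ * β := by gcongr; exact hg_le t
      _ ≤ 1 / 2 := by
          have h5 : t₀ * β = 1 / 4 := by rw [ht₀]; field_simp
          nlinarith
  have hZ : ∀ t, 0 ≤ t → t ≤ t₀ → ‖Z‖ ^ 2 ≤ 4 * κ * g t := by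
    intro t h0 h1
    -- The flow is still near `1`, so half of `‖Z‖` is absorbed and the input `Z * E t` has size at
    -- least `‖Z‖ / 2`.
    have e1 : ‖Z‖ ≤ ‖Z * E t‖ + ‖Z‖ * (1 / 2) := by
      have : Z = Z * E t - Z * (E t - 1) := by rw [Matrix.mul_sub, Matrix.mul_one]; abel
      calc ‖Z‖ = ‖Z * E t - Z * (E t - 1)‖ := by rw [← this]
        _ ≤ ‖Z * E t‖ + ‖Z * (E t - 1)‖ := norm_sub_le _ _
        _ ≤ _ := by
          gcongr
          exact (frobenius_norm_mul _ _).trans (by gcongr; exact hclose t h0 h1)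
    have e2 : ‖Z‖ ≤ 2 * ‖Z * E t‖ := by linarith
    calc ‖Z‖ ^ 2 ≤ (2 * ‖Z * E t‖) ^ 2 := by gcongr
      _ = 4 * ‖Z * E t‖ ^ 2 := by ring
      _ ≤ 4 * κ * g t := by rw [mul_assoc]; gcongr; exact h₂ t
  have hgi : IntegrableOn g (Set.Ioc 0 t₀) := hg.mono_set (hIoc t₀)
  have hint : t₀ * ‖Z‖ ^ 2 ≤ 4 * κ * a := by
    calc t₀ * ‖Z‖ ^ 2 = ∫ _ in Set.Ioc 0 t₀, ‖Z‖ ^ 2 := by simp [ht₀0.le]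
      _ ≤ ∫ t in Set.Ioc 0 t₀, 4 * κ * g t :=
          setIntegral_mono_on (by simp) (hgi.const_mul _) measurableSet_Ioc
            fun t ht => hZ t ht.1.le ht.2
      _ ≤ 4 * κ * a := by rw [integral_const_mul]; gcongr; exact hg_le t₀
  have h4 : 4 * β * t₀ = 1 := by rw [ht₀]; field_simp
  calc ‖Z‖ ^ 2 = 4 * β * (t₀ * ‖Z‖ ^ 2) := by rw [← mul_assoc, h4, one_mul]
    _ ≤ 4 * β * (4 * κ * a) := by gcongr
    _ = 16 * β * κ * a := by ring

namespace ODCSystem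

variable {n m p : ℕ}

/-- The matrix `[I; -K C]` that maps the state to the pair (state, input). -/
def stateInput (G : ODCSystem n m p) (K : Matrix (Fin m) (Fin p) ℝ) :
    Matrix (Fin n ⊕ Fin m) (Fin n) ℝ :=
  fromRows (1 : Matrix (Fin n) (Fin n) ℝ) (-(K * G.C))

/-- The weighted closed-loop trajectories of state and input. -/
noncomputable def trajectory (G : ODCSystem n m p)
    (V : Matrix (Fin n ⊕ Fin m) (Fin n ⊕ Fin m) ℝ) (L : Matrix (Fin n) (Fin n) ℝ)
    (K : Matrix (Fin m) (Fin p) ℝ) (t : ℝ) : Matrix (Fin n ⊕ Fin m) (Fin n) ℝ :=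
  V * G.stateInput K * NormedSpace.exp (t • G.closedLoop K) * L

/-- The cost as an extended nonnegative number, meaningful for every gain. -/
noncomputable def extCost (G : ODCSystem n m p)
    (V : Matrix (Fin n ⊕ Fin m) (Fin n ⊕ Fin m) ℝ) (L : Matrix (Fin n) (Fin n) ℝ)
    (K : Matrix (Fin m) (Fin p) ℝ) : ENNReal :=
  ∫⁻ t in Set.Ioi (0 : ℝ), ENNReal.ofReal (‖G.trajectory V L K t‖ ^ 2)

theorem closedLoopWeight_eq (G : ODCSystem n m p) (w : ODCCost n m)
    (K : Matrix (Fin m) (Fin p) ℝ) :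
    G.closedLoopWeight w K = (G.stateInput K)ᵀ * w.weight * G.stateInput K := by
  rw [stateInput, transpose_fromRows, ODCCost.weight, fromCols_mul_fromBlocks,
    fromCols_mul_fromRows, closedLoopWeight]
  simp only [transpose_one, Matrix.one_mul, Matrix.mul_one, transpose_neg, transpose_mul,
    Matrix.neg_mul, Matrix.mul_neg, Matrix.add_mul, Matrix.mul_assoc, neg_add_rev, neg_neg]
  abel

theorem continuous_closedLoop (G : ODCSystem n m p) : Continuous G.closedLoop :=
  continuous_const.sub ((continuous_const.matrix_mul continuous_id).matrix_mul continuous_const)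

theorem continuous_stateInput (G : ODCSystem n m p) : Continuous G.stateInput := by
  refine continuous_matrix fun i j => ?_
  have h : Continuous fun K : Matrix (Fin m) (Fin p) ℝ => -(K * G.C) :=
    (continuous_id.matrix_mul continuous_const).neg
  rcases i with i | i
  · simpa [stateInput] using continuous_const
  · simpa [stateInput] using h.matrix_elem i j

theorem continuous_trajectory (G : ODCSystem n m p)
    (V : Matrix (Fin n ⊕ Fin m) (Fin n ⊕ Fin m) ℝ) (L : Matrix (Fin n) (Fin n) ℝ) :
    Continuous (Function.uncurry (G.trajectory V L)) := by
  have hexp : Continuous fun q : Matrix (Fin m) (Fin p) ℝ × ℝ =>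
      NormedSpace.exp (q.2 • G.closedLoop q.1) :=
    NormedSpace.exp_continuous.comp
      (continuous_snd.smul (G.continuous_closedLoop.comp continuous_fst))
  exact (((continuous_const.matrix_mul (G.continuous_stateInput.comp continuous_fst)).matrix_mul
    hexp).matrix_mul continuous_const)

theorem lowerSemicontinuous_extCost (G : ODCSystem n m p)
    (V : Matrix (Fin n ⊕ Fin m) (Fin n ⊕ Fin m) ℝ) (L : Matrix (Fin n) (Fin n) ℝ) :
    LowerSemicontinuous (G.extCost V L) :=
  have : FirstCountableTopology (Matrix (Fin m) (Fin p) ℝ) :=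
    inferInstanceAs (FirstCountableTopology (Fin m → Fin p → ℝ))
  lowerSemicontinuous_lintegral_of_continuous
    (ENNReal.continuous_ofReal.comp ((G.continuous_trajectory V L).norm.pow 2))

/-- The integrand of the Gramian. -/
noncomputable def gramianIntegrand (G : ODCSystem n m p) (w : ODCCost n m)
    (K : Matrix (Fin m) (Fin p) ℝ) (t : ℝ) : Matrix (Fin n) (Fin n) ℝ :=
  NormedSpace.exp (t • (G.closedLoop K).transpose) * G.closedLoopWeight w K
    * NormedSpace.exp (t • G.closedLoop K)

theorem integrableOn_gramianIntegrand (G : ODCSystem n m p) (w : ODCCost n m)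
    {K : Matrix (Fin m) (Fin p) ℝ} (hK : K ∈ G.stabilizing) (i j : Fin n) :
    IntegrableOn (fun t => G.gramianIntegrand w K t i j) (Set.Ioi 0) := by
  obtain ⟨C, δ, hδ, hC⟩ := IsHurwitz.exists_norm_exp_le hK
  have hcont : Continuous (G.gramianIntegrand w K) :=
    ((continuous_exp_smul _).mul continuous_const).mul (continuous_exp_smul _)
  refine Integrable.mono' (g := fun t => C ^ 2 * ‖G.closedLoopWeight w K‖ * Real.exp (-(2 * δ) * t))
    ((exp_neg_integrableOn_Ioi 0 (by positivity)).const_mul _)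
    (hcont.matrix_elem i j).aestronglyMeasurable ?_
  refine (ae_restrict_iff' measurableSet_Ioi).mpr (ae_of_all _ fun t ht => ?_)
  have h := hC t (le_of_lt ht)
  calc ‖G.gramianIntegrand w K t i j‖ ≤ ‖G.gramianIntegrand w K t‖ :=
        abs_entry_le_frobenius_norm _ i j
    _ ≤ ‖NormedSpace.exp (t • (G.closedLoop K)ᵀ)‖ * ‖G.closedLoopWeight w K‖
          * ‖NormedSpace.exp (t • G.closedLoop K)‖ :=
        (norm_mul_le _ _).trans (by gcongr; exact norm_mul_le _ _)
    _ = ‖NormedSpace.exp (t • G.closedLoop K)‖ ^ 2 * ‖G.closedLoopWeight w K‖ := by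
        rw [← transpose_smul, Matrix.exp_transpose, frobenius_norm_transpose]; ring
    _ ≤ (C * Real.exp (-δ * t)) ^ 2 * ‖G.closedLoopWeight w K‖ := by gcongr
    _ = C ^ 2 * ‖G.closedLoopWeight w K‖ * Real.exp (-(2 * δ) * t) := by
        rw [mul_pow, ← Real.exp_nat_mul]; push_cast; ring_nf

section Factorization

variable (G : ODCSystem n m p) {w : ODCCost n m}
  {V V' : Matrix (Fin n ⊕ Fin m) (Fin n ⊕ Fin m) ℝ} {L L' : Matrix (Fin n) (Fin n) ℝ}

theorem sq_norm_trajectory (hV : w.weight = Vᵀ * V) (hL : w.D₀ = L * Lᵀ)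
    (K : Matrix (Fin m) (Fin p) ℝ) (t : ℝ) :
    ‖G.trajectory V L K t‖ ^ 2 = (G.gramianIntegrand w K t * w.D₀).trace := by
  rw [sq_norm_eq_trace, gramianIntegrand, closedLoopWeight_eq, hV, hL, ← Matrix.mul_assoc,
    Matrix.trace_mul_comm _ Lᵀ, trajectory, ← transpose_smul, Matrix.exp_transpose]
  simp only [transpose_mul, Matrix.mul_assoc]

/-- Exponential decay makes every Gramian entry integrable, which justifies exchanging the trace
with the entrywise integrals. -/
theorem integrableOn_trajectory (hV : w.weight = Vᵀ * V) (hL : w.D₀ = L * Lᵀ)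
    {K : Matrix (Fin m) (Fin p) ℝ} (hK : K ∈ G.stabilizing) :
    IntegrableOn (fun t => ‖G.trajectory V L K t‖ ^ 2) (Set.Ioi 0) ∧
      G.cost w K = ∫ t in Set.Ioi 0, ‖G.trajectory V L K t‖ ^ 2 := by
  have hentry : ∀ i j, IntegrableOn (fun t => G.gramianIntegrand w K t i j) (Set.Ioi 0) :=
    G.integrableOn_gramianIntegrand w hK
  have hterm : ∀ i j, Integrable (fun t => G.gramianIntegrand w K t i j * w.D₀ j i)
      (volume.restrict (Set.Ioi 0)) := fun i j => (hentry i j).mul_const _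
  simp only [G.sq_norm_trajectory hV hL, Matrix.trace, Matrix.diag_apply, Matrix.mul_apply, cost]
  refine ⟨integrable_finsetSum _ fun i _ => integrable_finsetSum _ fun j _ => hterm i j, ?_⟩
  rw [integral_finsetSum _ fun i _ => integrable_finsetSum _ fun j _ => hterm i j]
  refine Finset.sum_congr rfl fun i _ => ?_
  rw [integral_finsetSum _ fun j _ => hterm i j]
  exact Finset.sum_congr rfl fun j _ => (integral_mul_const _ _).symm

theorem extCost_eq_ofReal_cost (hV : w.weight = Vᵀ * V) (hL : w.D₀ = L * Lᵀ)
    {K : Matrix (Fin m) (Fin p) ℝ} (hK : K ∈ G.stabilizing) :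
    G.extCost V L K = ENNReal.ofReal (G.cost w K) := by
  obtain ⟨hint, hcost⟩ := G.integrableOn_trajectory hV hL hK
  rw [hcost, ofReal_integral_eq_lintegral_ofReal hint (ae_of_all _ fun t => sq_nonneg _), extCost]

theorem cost_nonneg (hV : w.weight = Vᵀ * V) (hL : w.D₀ = L * Lᵀ)
    {K : Matrix (Fin m) (Fin p) ℝ} (hK : K ∈ G.stabilizing) : 0 ≤ G.cost w K := by
  rw [(G.integrableOn_trajectory hV hL hK).2]
  exact integral_nonneg fun t => sq_nonneg _

/-- The invertible factors `V` and `L` can be undone, so the weighted energy density controls both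
the state and the input, with one constant for all gains and times. -/
theorem exists_norm_sq_le_trajectory (hV' : V' * V = 1) (hL' : L * L' = 1) :
    ∃ κ : ℝ, 0 ≤ κ ∧ ∀ K t,
      ‖NormedSpace.exp (t • G.closedLoop K)‖ ^ 2 ≤ κ * ‖G.trajectory V L K t‖ ^ 2 ∧
      ‖K * G.C * NormedSpace.exp (t • G.closedLoop K)‖ ^ 2 ≤ κ * ‖G.trajectory V L K t‖ ^ 2 := by
  -- `P` and `Q` read off the two blocks: `P [I; -K C] = I` and `Q [I; -K C] = K C`.
  set P : Matrix (Fin n) (Fin n ⊕ Fin m) ℝ := fromCols 1 0 with hP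
  set Q : Matrix (Fin m) (Fin n ⊕ Fin m) ℝ := fromCols 0 (-1) with hQ
  set κ := (‖P * V'‖ * ‖L'‖) ^ 2 + (‖Q * V'‖ * ‖L'‖) ^ 2 with hκ
  have key : ∀ K t, G.stateInput K * NormedSpace.exp (t • G.closedLoop K)
      = V' * G.trajectory V L K t * L' := by
    intro K t
    calc _ = V' * V * (G.stateInput K * NormedSpace.exp (t • G.closedLoop K)) * (L * L') := by
          rw [hV', hL', Matrix.one_mul, Matrix.mul_one]
      _ = _ := by simp only [trajectory, Matrix.mul_assoc]
  have hproj : ∀ {k : ℕ} (R : Matrix (Fin k) (Fin n ⊕ Fin m) ℝ) K t,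
      ‖R * G.stateInput K * NormedSpace.exp (t • G.closedLoop K)‖ ^ 2
        ≤ (‖R * V'‖ * ‖L'‖) ^ 2 * ‖G.trajectory V L K t‖ ^ 2 := by
    intro k R K t
    rw [Matrix.mul_assoc, key, ← mul_pow]
    refine pow_le_pow_left₀ (norm_nonneg _) ?_ 2
    rw [← Matrix.mul_assoc, ← Matrix.mul_assoc]
    calc _ ≤ ‖R * V'‖ * ‖G.trajectory V L K t‖ * ‖L'‖ :=
          (frobenius_norm_mul _ _).trans (by gcongr; exact frobenius_norm_mul _ _)
      _ = _ := by ring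
  refine ⟨κ, by positivity, fun K t => ⟨?_, ?_⟩⟩
  · have := hproj P K t
    rw [hP, stateInput, fromCols_mul_fromRows, Matrix.one_mul, Matrix.zero_mul, add_zero,
      Matrix.one_mul] at this
    refine this.trans ?_
    gcongr
    exact le_add_of_nonneg_right (sq_nonneg _)
  · have := hproj Q K t
    rw [hQ, stateInput, fromCols_mul_fromRows, Matrix.zero_mul, Matrix.neg_mul, Matrix.mul_neg,
      neg_neg, Matrix.one_mul, zero_add] at this
    refine this.trans ?_
    gcongr
    exact le_add_of_nonneg_left (sq_nonneg _)

theorem stabilizing_iff_extCost_lt_top (hV : w.weight = Vᵀ * V) (hL : w.D₀ = L * Lᵀ)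
    (hV' : V' * V = 1) (hL' : L * L' = 1) {K : Matrix (Fin m) (Fin p) ℝ} :
    K ∈ G.stabilizing ↔ G.extCost V L K < ⊤ := by
  refine ⟨fun hK => by rw [G.extCost_eq_ofReal_cost hV hL hK]; exact ENNReal.ofReal_lt_top,
    fun h => isHurwitz_of_lintegral_exp_ne_top ?_⟩
  obtain ⟨κ, hκ, hle⟩ := G.exists_norm_sq_le_trajectory (V := V) (L := L) hV' hL'
  refine ne_top_of_le_ne_top (ENNReal.mul_ne_top (ENNReal.ofReal_ne_top (r := κ)) h.ne) ?_
  rw [extCost, ← lintegral_const_mul' _ _ ENNReal.ofReal_ne_top]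
  refine lintegral_mono fun t => ?_
  rw [← ENNReal.ofReal_mul hκ]
  exact ENNReal.ofReal_le_ofReal (hle K t).1

/-- Closedness is lower semicontinuity. For boundedness, `sq_norm_gain_le` bounds `K C`, and the
right inverse `D` of `C` recovers `K`. -/
theorem isCompact_setOf_extCost_le (hV : w.weight = Vᵀ * V) (hL : w.D₀ = L * Lᵀ)
    (hV' : V' * V = 1) (hL' : L * L' = 1) {D : Matrix (Fin n) (Fin p) ℝ} (hD : G.C * D = 1)
    {α : ENNReal} (hα : α < ⊤) : IsCompact {K | G.extCost V L K ≤ α} := by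
  have : ProperSpace (Matrix (Fin m) (Fin p) ℝ) := FiniteDimensional.proper ℝ _
  refine Metric.isCompact_of_isClosed_isBounded
    ((G.lowerSemicontinuous_extCost V L).isClosed_preimage α) ?_
  obtain ⟨κ, hκ, hle⟩ := G.exists_norm_sq_le_trajectory (V := V) (L := L) hV' hL'
  refine isBounded_iff_forall_norm_le.mpr
    ⟨Real.sqrt (16 * ((‖G.A‖ + ‖G.B‖) ^ 2 * κ * α.toReal + 1) * κ * α.toReal) * ‖D‖,
      fun K (hK : G.extCost V L K ≤ α) => ?_⟩
  have hst : K ∈ G.stabilizing :=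
    (G.stabilizing_iff_extCost_lt_top hV hL hV' hL').mpr (hK.trans_lt hα)
  obtain ⟨hint, hcost⟩ := G.integrableOn_trajectory hV hL hst
  have ha : ∫ t in Set.Ioi 0, ‖G.trajectory V L K t‖ ^ 2 ≤ α.toReal := by
    rw [← hcost, ← ENNReal.ofReal_le_iff_le_toReal hα.ne, ← G.extCost_eq_ofReal_cost hV hL hst]
    exact hK
  have hKC : ‖K * G.C‖ ^ 2 ≤ _ := sq_norm_gain_le (A := G.A) (B := G.B) (M := G.closedLoop K)
    (by rw [closedLoop, Matrix.mul_assoc]) hκ hint (fun t => sq_nonneg _) ha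
    (fun t => (hle K t).1) (fun t => (hle K t).2)
  calc ‖K‖ = ‖K * G.C * D‖ := by rw [Matrix.mul_assoc, hD, Matrix.mul_one]
    _ ≤ ‖K * G.C‖ * ‖D‖ := frobenius_norm_mul _ _
    _ ≤ _ := by gcongr; exact Real.le_sqrt_of_sq_le hKC

end Factorization

end ODCSystem

end CostAnalysis
-- Minima in separated pieces, with and without penalty
section LocalMinima

open Filter Topology

/-- A lower semicontinuous extended-valued objective `f` with compact sublevel sets has, under a
closed constraint `S` whose feasible set is split by disjoint open sets `W i`, a constrained local
minimum in every piece. -/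
theorem exists_isLocalMinOn_of_isOpen_cover {X ι : Type*} [TopologicalSpace X]
    {f : X → ENNReal} (hf : LowerSemicontinuous f)
    (hcomp : ∀ α : ENNReal, α < ⊤ → IsCompact {x | f x ≤ α}) {S : Set X} (hS : IsClosed S)
    {W : ι → Set X} (hWo : ∀ i, IsOpen (W i)) (hWd : Pairwise fun i j => Disjoint (W i) (W j))
    (hcov : ∀ x ∈ S, f x < ⊤ → ∃ i, x ∈ W i) {i : ι} {x₀ : X} (hx₀ : x₀ ∈ S ∩ W i)
    (hfx₀ : f x₀ < ⊤) :
    ∃ x ∈ S ∩ W i, f x < ⊤ ∧ ∀ y ∈ S ∩ W i, f x ≤ f y := by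
  -- `W i` is open, so the minimum is sought in the closed complement of the other pieces, which
  -- contains `W i` and agrees with it on feasible points.
  set F : Set X := {y | f y ≤ f x₀} ∩ (S ∩ ⋂ j ∈ {j | j ≠ i}, (W j)ᶜ) with hF
  have hW_sub : ∀ y ∈ W i, y ∈ ⋂ j ∈ {j | j ≠ i}, (W j)ᶜ := fun y hy =>
    Set.mem_iInter₂.mpr fun j hj hyj => Set.disjoint_left.mp (hWd hj) hyj hy
  have hFc : IsCompact F := (hcomp _ hfx₀).inter_right
    (hS.inter (isClosed_biInter fun j _ => (hWo j).isClosed_compl))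
  have hx₀F : x₀ ∈ F := ⟨le_refl (f x₀), hx₀.1, hW_sub _ hx₀.2⟩
  obtain ⟨x, hxF, hx⟩ := (hf.lowerSemicontinuousOn F).exists_isMinOn ⟨x₀, hx₀F⟩ hFc
  have hxt : f x < ⊤ := lt_of_le_of_lt hxF.1 hfx₀
  have hxW : x ∈ W i := by
    obtain ⟨j, hj⟩ := hcov x hxF.2.1 hxt
    by_cases hji : j = i
    · exact hji ▸ hj
    · exact absurd hj (Set.mem_iInter₂.mp hxF.2.2 j hji)
  refine ⟨x, ⟨hxF.2.1, hxW⟩, hxt, fun y hy => ?_⟩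
  rcases le_total (f y) (f x₀) with h | h
  · exact hx ⟨h, hy.1, hW_sub _ hy.2⟩
  · exact le_trans hxF.1 h

/-- Exact-penalty version of `exists_isLocalMinOn_of_isOpen_cover`: if the penalty weight is large
enough, the penalized objective has a minimum over every open piece. -/
theorem exists_penalized_min_of_isOpen_cover {X ι : Type*} [TopologicalSpace X] [Finite ι]
    {f : X → ENNReal} (hf : LowerSemicontinuous f)
    (hcomp : ∀ α : ENNReal, α < ⊤ → IsCompact {x | f x ≤ α}) {S : Set X}
    {W : ι → Set X} (hWo : ∀ i, IsOpen (W i)) (hWd : Pairwise fun i j => Disjoint (W i) (W j))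
    (hcov : ∀ x ∈ S, f x < ⊤ → ∃ i, x ∈ W i)
    (hne : ∀ i, ∃ x ∈ S ∩ W i, f x < ⊤)
    {h : X → ℝ} (hh : Continuous h) (hh0 : ∀ x, 0 ≤ h x) (hhS : ∀ x, h x = 0 ↔ x ∈ S) :
    ∃ c₀ : ℝ, 0 < c₀ ∧ ∀ c : ℝ, c₀ ≤ c → ∀ i, ∃ x ∈ W i, f x < ⊤ ∧
      ∀ y ∈ W i, f x + ENNReal.ofReal (c * h x) ≤ f y + ENNReal.ofReal (c * h y) := by
  choose x₀ hx₀ hfx₀ using hne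
  obtain ⟨α, hα, hα_le⟩ : ∃ α : ENNReal, α < ⊤ ∧ ∀ i, f (x₀ i) ≤ α := by
    have := Fintype.ofFinite ι
    refine ⟨Finset.univ.sup fun i => f (x₀ i), ?_, fun i =>
      Finset.le_sup (f := fun i => f (x₀ i)) (Finset.mem_univ i)⟩
    exact (Finset.sup_lt_iff ENNReal.coe_lt_top).mpr fun i _ => hfx₀ i
  -- A zero of `h` on this compact set would be a feasible point outside every piece, contradicting
  -- the cover.
  obtain ⟨δ, hδ, hδ_le⟩ : ∃ δ : ℝ, 0 < δ ∧ ∀ x, f x ≤ α → (∀ i, x ∉ W i) → δ ≤ h x := by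
    set N : Set X := {x | f x ≤ α} ∩ ⋂ i, (W i)ᶜ with hN
    have hNc : IsCompact N :=
      (hcomp α hα).inter_right (isClosed_iInter fun i => (hWo i).isClosed_compl)
    rcases N.eq_empty_or_nonempty with he | hne
    · exact ⟨1, one_pos, fun x hx hxW => absurd (show x ∈ N from ⟨hx, Set.mem_iInter.mpr hxW⟩)
        (he ▸ Set.notMem_empty x)⟩
    · obtain ⟨z, hzN, hz⟩ := hNc.exists_isMinOn hne hh.continuousOn
      refine ⟨h z, (hh0 z).lt_of_ne fun h0 => ?_, fun x hx hxW => hz ⟨hx, Set.mem_iInter.mpr hxW⟩⟩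
      obtain ⟨i, hi⟩ := hcov z ((hhS z).mp h0.symm) (lt_of_le_of_lt hzN.1 hα)
      exact Set.mem_iInter.mp hzN.2 i hi
  refine ⟨(α.toReal + 1) / δ, by positivity, fun c hc i => ?_⟩
  have hc0 : 0 < c := lt_of_lt_of_le (by positivity) hc
  have hcδ : α.toReal < c * δ := by
    rw [div_le_iff₀ hδ] at hc; linarith
  set g : X → ENNReal := fun x => f x + ENNReal.ofReal (c * h x) with hg
  have hgl : LowerSemicontinuous g := hf.add
    (ENNReal.continuous_ofReal.comp (continuous_const.mul hh)).lowerSemicontinuous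
  set F : Set X := {y | f y ≤ α} ∩ ⋂ j ∈ {j | j ≠ i}, (W j)ᶜ with hF
  have hW_sub : ∀ y ∈ W i, y ∈ ⋂ j ∈ {j | j ≠ i}, (W j)ᶜ := fun y hy =>
    Set.mem_iInter₂.mpr fun j hj hyj => Set.disjoint_left.mp (hWd hj) hyj hy
  have hFc : IsCompact F := (hcomp _ hα).inter_right
    (isClosed_biInter fun j _ => (hWo j).isClosed_compl)
  have hx₀F : x₀ i ∈ F := ⟨hα_le i, hW_sub _ (hx₀ i).2⟩
  obtain ⟨x, hxF, hx⟩ := (hgl.lowerSemicontinuousOn F).exists_isMinOn ⟨x₀ i, hx₀F⟩ hFc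
  have hgx : g x ≤ α := by
    refine (hx hx₀F).trans ?_
    simpa [hg, (hhS _).mpr (hx₀ i).1] using hα_le i
  -- Outside `W i` the penalty alone would be at least `c δ > α`, while `g x ≤ g (x₀ i) ≤ α` because
  -- `h` vanishes at `x₀ i`.
  have hxW : x ∈ W i := by
    by_contra hxi
    have hδx : δ ≤ h x := hδ_le x hxF.1 fun j => by
      by_cases hji : j = i
      · exact hji ▸ hxi
      · exact Set.mem_iInter₂.mp hxF.2 j hji
    have h1 : ENNReal.ofReal (c * h x) ≤ α := le_trans le_add_self hgx
    have h2 : c * h x ≤ α.toReal := by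
      rwa [ENNReal.ofReal_le_iff_le_toReal hα.ne] at h1
    nlinarith [mul_le_mul_of_nonneg_left hδx hc0.le]
  refine ⟨x, hxW, lt_of_le_of_lt hxF.1 hα, fun y hy => ?_⟩
  rcases le_total (f y) α with h | h
  · exact hx ⟨h, hW_sub _ hy⟩
  · exact hgx.trans (h.trans le_self_add)

end LocalMinima
-- Counting local minima
section ManyLocalMinima

open Matrix Filter Topology

namespace ODCSystem

/-- If disjoint open sets `W i` cover the stabilizing gains in `S` and each contains one of them,
then each `W i` contains a local minimum of the constrained problem, and of the penalized problem
for all large penalty weights. -/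
theorem exists_finset_localMin {n m p : ℕ} (G : ODCSystem n m p) {w : ODCCost n m}
    (hw : w.weight.PosDef) (hD₀ : w.D₀.PosDef) {D : Matrix (Fin n) (Fin p) ℝ} (hD : G.C * D = 1)
    {ι : Type*} [Fintype ι] {W : ι → Set (Matrix (Fin m) (Fin p) ℝ)} (hWo : ∀ i, IsOpen (W i))
    (hWd : Pairwise fun i j => Disjoint (W i) (W j))
    (hcov : ∀ K ∈ G.S, K ∈ G.stabilizing → ∃ i, K ∈ W i)
    (hne : ∀ i, ∃ K ∈ G.S, K ∈ G.stabilizing ∧ K ∈ W i) :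
    (∃ T : Finset (Matrix (Fin m) (Fin p) ℝ),
      (∀ K ∈ T, G.IsConstrainedLocalMin w K) ∧ T.card = Fintype.card ι) ∧
    ∀ h : Matrix (Fin m) (Fin p) ℝ → ℝ, G.IsPenalty h → ∃ c₀ : ℝ, 0 < c₀ ∧ ∀ c : ℝ, c₀ ≤ c →
      ∃ T : Finset (Matrix (Fin m) (Fin p) ℝ),
        (∀ K ∈ T, G.IsPenalizedLocalMin w h c K) ∧ T.card = Fintype.card ι := by
  obtain ⟨V, V', hV', hV⟩ := hw.exists_transpose_mul_self
  obtain ⟨U, U', hU', hU⟩ := hD₀.exists_transpose_mul_self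
  have hL : w.D₀ = Uᵀ * Uᵀᵀ := by rw [transpose_transpose, hU]
  have hL' : Uᵀ * U'ᵀ = 1 := by rw [← transpose_mul, hU', transpose_one]
  have hst : ∀ K, K ∈ G.stabilizing ↔ G.extCost V Uᵀ K < ⊤ := fun K =>
    G.stabilizing_iff_extCost_lt_top hV hL hV' hL'
  have hlsc := G.lowerSemicontinuous_extCost V Uᵀ
  have hcomp : ∀ α : ENNReal, α < ⊤ → IsCompact {K | G.extCost V Uᵀ K ≤ α} := fun α hα =>
    G.isCompact_setOf_extCost_le hV hL hV' hL' hD hα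
  have hcov' : ∀ K ∈ (G.S : Set (Matrix (Fin m) (Fin p) ℝ)), G.extCost V Uᵀ K < ⊤ →
      ∃ i, K ∈ W i := fun K hK h => hcov K hK ((hst K).mpr h)
  have hfinset : ∀ P : Matrix (Fin m) (Fin p) ℝ → Prop, (∀ i, ∃ K ∈ W i, P K) →
      ∃ T : Finset (Matrix (Fin m) (Fin p) ℝ), (∀ K ∈ T, P K) ∧ T.card = Fintype.card ι := by
    intro P hP
    choose x hxW hx using hP
    have hinj : Function.Injective x := fun i j hij => by_contra fun hij' =>
      Set.disjoint_left.mp (hWd hij') (hxW i) (hij ▸ hxW j)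
    exact ⟨Finset.univ.map ⟨x, hinj⟩, by simpa using hx,
      by rw [Finset.card_map, Finset.card_univ]⟩
  refine ⟨?_, fun h hh => ?_⟩
  · refine hfinset _ fun i => ?_
    obtain ⟨K₀, hK₀S, hK₀, hK₀W⟩ := hne i
    obtain ⟨K, ⟨hKS, hKW⟩, hKt, hmin⟩ := exists_isLocalMinOn_of_isOpen_cover hlsc hcomp
      G.S.closed_of_finiteDimensional hWo hWd hcov' ⟨hK₀S, hK₀W⟩ ((hst K₀).mp hK₀)
    have hKst := (hst K).mpr hKt
    refine ⟨K, hKW, ⟨hKst, hKS⟩, ?_⟩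
    filter_upwards [self_mem_nhdsWithin, mem_nhdsWithin_of_mem_nhds ((hWo i).mem_nhds hKW)]
      with L hL₁ hL₂
    have := hmin L ⟨hL₁.2, hL₂⟩
    rwa [G.extCost_eq_ofReal_cost hV hL hKst, G.extCost_eq_ofReal_cost hV hL hL₁.1,
      ENNReal.ofReal_le_ofReal_iff (G.cost_nonneg hV hL hL₁.1)] at this
  · obtain ⟨c₀, hc₀, hc⟩ := exists_penalized_min_of_isOpen_cover hlsc hcomp hWo hWd hcov'
      (fun i => by
        obtain ⟨K, hKS, hK, hKW⟩ := hne i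
        exact ⟨K, ⟨hKS, hKW⟩, (hst K).mp hK⟩) hh.continuous hh.nonneg hh.eq_zero_iff
    refine ⟨c₀, hc₀, fun c hcc => ?_⟩
    have hc0 : 0 ≤ c := hc₀.le.trans hcc
    refine hfinset _ fun i => ?_
    obtain ⟨K, hKW, hKt, hmin⟩ := hc c hcc i
    have hKst := (hst K).mpr hKt
    refine ⟨K, hKW, hKst, ?_⟩
    filter_upwards [self_mem_nhdsWithin, mem_nhdsWithin_of_mem_nhds ((hWo i).mem_nhds hKW)]
      with L hL₁ hL₂
    have hJ := G.cost_nonneg hV hL hL₁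
    have hp := mul_nonneg hc0 (hh.nonneg L)
    have := hmin L hL₂
    rwa [G.extCost_eq_ofReal_cost hV hL hKst, G.extCost_eq_ofReal_cost hV hL hL₁,
      ← ENNReal.ofReal_add (G.cost_nonneg hV hL hKst) (mul_nonneg hc0 (hh.nonneg K)),
      ← ENNReal.ofReal_add hJ hp, ENNReal.ofReal_le_ofReal_iff (add_nonneg hJ hp)] at this

end ODCSystem

/-! ### The decoupled two-state plants -/

/-- `M + 1` is nilpotent, so the only possible eigenvalue is `-1`. -/
theorem isHurwitz_of_add_one_mul_self_eq_zero {n : ℕ} {M : Matrix (Fin n) (Fin n) ℝ}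
    (h : (M + 1) * (M + 1) = 0) : IsHurwitz M := by
  intro z hz
  obtain ⟨v, hv0, hv⟩ := exists_eigencolumn hz
  have hmap : (M.map (fun x : ℝ => (x : ℂ)) + 1) * (M.map (fun x : ℝ => (x : ℂ)) + 1) = 0 := by
    have := congrArg (Complex.ofRealHom.mapMatrix : Matrix (Fin n) (Fin n) ℝ →+* _) h
    rw [map_mul, map_add, map_one, map_zero] at this
    exact this
  have h1 : (M.map (fun x : ℝ => (x : ℂ)) + 1) * v = (z + 1) • v := by
    rw [Matrix.add_mul, hv, Matrix.one_mul, add_smul, one_smul]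
  have h2 : ((z + 1) * (z + 1)) • v = 0 := by
    rw [← smul_smul, ← h1, ← Matrix.mul_smul, ← h1, ← Matrix.mul_assoc, hmap, Matrix.zero_mul]
  have h3 : z + 1 = 0 := by
    simpa [hv0] using h2
  rw [eq_neg_of_add_eq_zero_left h3]
  norm_num

/-- The system made of `n / 2` decoupled two-state plants `[-1, 2; 2, -1]` (and one stable scalar
plant if `n` is odd), full actuation and sensing, and gains that are skew within each plant: each
closed loop is `[-1, 2 - k; 2 + k, -1]`. -/
def pairSystem (n : ℕ) : ODCSystem n n n where
  A := Matrix.of fun i j => if i = j then -1 else if i.val / 2 = j.val / 2 then 2 else 0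
  B := 1
  C := 1
  S :=
    { carrier := {K | (∀ i j, K j i = -K i j) ∧ ∀ i j : Fin n, i.val / 2 ≠ j.val / 2 → K i j = 0}
      add_mem' := fun {K L} hK hL =>
        ⟨fun i j => by rw [Matrix.add_apply, Matrix.add_apply, hK.1 i j, hL.1 i j, neg_add],
          fun i j h => by rw [Matrix.add_apply, hK.2 i j h, hL.2 i j h, add_zero]⟩
      zero_mem' := ⟨fun i j => by simp, fun i j _ => rfl⟩
      smul_mem' := fun c K hK =>
        ⟨fun i j => by rw [Matrix.smul_apply, Matrix.smul_apply, hK.1 i j, smul_neg],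
          fun i j h => by rw [Matrix.smul_apply, hK.2 i j h, smul_zero]⟩ }

namespace pairSystem

variable {n : ℕ}

theorem mem_S_iff {K : Matrix (Fin n) (Fin n) ℝ} : K ∈ (pairSystem n).S ↔
    (∀ i j, K j i = -K i j) ∧ ∀ i j : Fin n, i.val / 2 ≠ j.val / 2 → K i j = 0 :=
  Iff.rfl

theorem closedLoop_apply (K : Matrix (Fin n) (Fin n) ℝ) (i j : Fin n) :
    (pairSystem n).closedLoop K i j
      = (if i = j then -1 else if i.val / 2 = j.val / 2 then 2 else 0) - K i j := by
  simp [ODCSystem.closedLoop, pairSystem]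

/-- The first state of the `l`-th plant. -/
def fst (l : Fin (n / 2)) : Fin n := ⟨2 * l, by omega⟩

/-- The second state of the `l`-th plant. -/
def snd (l : Fin (n / 2)) : Fin n := ⟨2 * l + 1, by omega⟩

/-- With zero gain the plant stays `[-1, 2; 2, -1]`, and `(1, 1)` is an eigenvector for the unstable
eigenvalue `1`. -/
theorem gain_ne_zero {K : Matrix (Fin n) (Fin n) ℝ} (hS : K ∈ (pairSystem n).S)
    (hK : K ∈ (pairSystem n).stabilizing) (l : Fin (n / 2)) : K (fst l) (snd l) ≠ 0 := by
  intro h0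
  obtain ⟨hskew, hblock⟩ := mem_S_iff.mp hS
  have hdiag : ∀ i, K i i = 0 := fun i => by linarith [hskew i i]
  have h0' : K (snd l) (fst l) = 0 := by rw [hskew, h0, neg_zero]
  have hab : fst l ≠ snd l := fun h => by
    have := congrArg Fin.val h
    simp [fst, snd] at this
  set M := (pairSystem n).closedLoop K with hM
  have hsum : ∀ i, M i (fst l) + M i (snd l)
      = (Pi.single (fst l) 1 : Fin n → ℝ) i + (Pi.single (snd l) 1 : Fin n → ℝ) i := by
    intro i
    have hdiv : (fst l).val / 2 = (snd l).val / 2 := by simp only [fst, snd]; omega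
    rw [hM, closedLoop_apply, closedLoop_apply]
    by_cases hia : i = fst l
    · subst hia
      simp only [hab, hdiv, hdiag, h0, Pi.single_eq_same, Pi.single_eq_of_ne hab, if_true, if_false]
      norm_num
    by_cases hib : i = snd l
    · subst hib
      simp only [hab.symm, hdiv, hdiag, h0', Pi.single_eq_same, Pi.single_eq_of_ne hab.symm,
        if_true, if_false]
      norm_num
    have hne : i.val / 2 ≠ (fst l).val / 2 := by
      intro h
      have h1 : i.val ≠ 2 * l := fun h => hia (Fin.ext h)
      have h2 : i.val ≠ 2 * l + 1 := fun h => hib (Fin.ext h)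
      simp only [fst] at h
      omega
    simp [hia, hib, hne, hdiv ▸ hne, hblock i _ hne, hblock i _ (hdiv ▸ hne)]
  have hspec : (1 : ℂ) ∈ spectrum ℂ (M.map (fun x : ℝ => (x : ℂ))) := by
    refine mem_spectrum_of_eigencolumn
      (v := Pi.single (fst l) (1 : ℂ) + Pi.single (snd l) (1 : ℂ)) ?_ ?_
    · intro h
      have := congrFun h (fst l)
      simp [Pi.single_eq_of_ne hab] at this
    · ext i
      have := congrArg (fun x : ℝ => (x : ℂ)) (hsum i)
      simp only [Complex.ofReal_add] at this
      rw [Matrix.mulVec_add, Matrix.mulVec_single_one, Matrix.mulVec_single_one, one_smul]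
      refine this.trans ?_
      simp only [Pi.add_apply, Pi.single_apply]
      split_ifs <;> simp
  have := hK 1 hspec
  norm_num at this

/-- The sign `±1` attached to a Boolean. -/
def sign (b : Bool) : ℝ := if b then 1 else -1

/-- The gains whose entries have the sign pattern `σ`. -/
def piece (σ : Fin (n / 2) → Bool) : Set (Matrix (Fin n) (Fin n) ℝ) :=
  {K | ∀ l, 0 < sign (σ l) * K (fst l) (snd l)}

theorem isOpen_piece (σ : Fin (n / 2) → Bool) : IsOpen (piece σ) := by
  have : piece σ = ⋂ l, {K | 0 < sign (σ l) * K (fst l) (snd l)} := by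
    ext K; simp [piece]
  rw [this]
  exact isOpen_iInter_of_finite fun l => isOpen_lt continuous_const
    (continuous_const.mul (continuous_id.matrix_elem _ _))

theorem disjoint_piece {σ τ : Fin (n / 2) → Bool} (h : σ ≠ τ) :
    Disjoint (piece σ) (piece τ) := by
  obtain ⟨l, hl⟩ := Function.ne_iff.mp h
  refine Set.disjoint_left.mpr fun K h1 h2 => ?_
  have h1 := h1 l
  have h2 := h2 l
  have h3 : sign (σ l) = -sign (τ l) := by
    cases hσ : σ l <;> cases hτ : τ l <;> simp_all [sign]
  rw [h3, neg_mul] at h1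
  linarith

theorem exists_mem_piece {K : Matrix (Fin n) (Fin n) ℝ} (hS : K ∈ (pairSystem n).S)
    (hK : K ∈ (pairSystem n).stabilizing) : ∃ σ, K ∈ piece σ := by
  refine ⟨fun l => decide (0 < K (fst l) (snd l)), fun l => ?_⟩
  rcases (gain_ne_zero hS hK l).lt_or_gt with h | h
  · simp [sign, h.not_gt, h]
  · simp [sign, h]

/-- With `k = ±2` one off-diagonal entry of each block vanishes, so the closed loop plus the
identity squares to zero. -/
theorem exists_stabilizing_mem_piece (σ : Fin (n / 2) → Bool) :
    ∃ K ∈ (pairSystem n).S, K ∈ (pairSystem n).stabilizing ∧ K ∈ piece σ := by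
  -- The default `2` is harmless: a last unpaired state has only a diagonal entry in its block, and
  -- that gain is `0`.
  set s : ℕ → ℝ := fun k => if h : k < n / 2 then 2 * sign (σ ⟨k, h⟩) else 2 with hs
  have hs2 : ∀ k, s k * s k = 4 := by
    intro k
    simp only [hs, sign]
    split_ifs <;> norm_num
  set K : Matrix (Fin n) (Fin n) ℝ := Matrix.of fun i j =>
    if i.val / 2 = j.val / 2 then (if i < j then s (i.val / 2) else if j < i then -s (i.val / 2)
      else 0) else 0 with hKdef
  refine ⟨K, mem_S_iff.mpr ⟨fun i j => ?_, fun i j h => by simp [hKdef, h]⟩,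
    isHurwitz_of_add_one_mul_self_eq_zero ?_, fun l => ?_⟩
  · by_cases h : i.val / 2 = j.val / 2
    · rcases lt_trichotomy i j with hij | hij | hij
      · simp [hKdef, h, hij, hij.not_gt]
      · simp [hKdef, hij]
      · simp [hKdef, h, hij, hij.not_gt]
    · simp [hKdef, h, Ne.symm h]
  · ext i j
    rw [Matrix.mul_apply, Matrix.zero_apply]
    -- Each term vanishes separately: the only nontrivial case has `j = i` and `k` its partner,
    -- giving `(2 - s)(2 + s) = 4 - s² = 0`.
    refine Finset.sum_eq_zero fun k _ => ?_
    simp only [Matrix.add_apply, closedLoop_apply, hKdef, Matrix.of_apply]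
    by_cases hik : i = k
    · subst hik; simp [Matrix.one_apply_eq]
    by_cases hkj : k = j
    · subst hkj; simp [Matrix.one_apply_eq]
    by_cases hik2 : i.val / 2 = k.val / 2
    swap
    · simp [hik, hik2]
    by_cases hkj2 : k.val / 2 = j.val / 2
    swap
    · simp [hkj, hkj2]
    have hij : j = i := by
      have h1 : i.val ≠ k.val := fun h => hik (Fin.ext h)
      have h2 : k.val ≠ j.val := fun h => hkj (Fin.ext h)
      exact Fin.ext (by omega)
    subst hij
    have := hs2 (k.val / 2)
    rcases lt_or_gt_of_ne hik with h | h
    · simp only [hik, hkj, hik2, h, h.not_gt, Matrix.one_apply_ne hik, Matrix.one_apply_ne hkj,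
        if_true, if_false]
      linarith
    · simp only [hik, hkj, hik2, h, h.not_gt, Matrix.one_apply_ne hik, Matrix.one_apply_ne hkj,
        if_true, if_false]
      linarith
  · have hdiv : (fst l).val / 2 = l := by simp [fst]
    have hdiv' : (snd l).val / 2 = l := by simp only [snd]; omega
    have hlt : fst l < snd l := by simp [fst, snd, Fin.lt_def]
    simp only [hKdef, Matrix.of_apply, hdiv, hdiv', hlt, if_true, hs, l.isLt, dif_pos, sign]
    split_ifs <;> norm_num

end pairSystem

/-- For odd `n` the floor loses a factor `√2`, which the constant `1 / 2` absorbs. -/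
theorem sqrt_two_pow_le (n : ℕ) : 1 / 2 * Real.sqrt 2 ^ n ≤ (2 : ℝ) ^ (n / 2) := by
  have h2 : Real.sqrt 2 ^ 2 = 2 := Real.sq_sqrt (by norm_num)
  have h1 : Real.sqrt 2 ≤ 2 := by
    rw [Real.sqrt_le_left (by norm_num)]; norm_num
  have hmod : Real.sqrt 2 ^ (n % 2) ≤ 2 := by
    rcases Nat.mod_two_eq_zero_or_one n with h | h <;> rw [h]
    · norm_num
    · simp [h1]
  calc 1 / 2 * Real.sqrt 2 ^ n
      = 1 / 2 * ((2 : ℝ) ^ (n / 2) * Real.sqrt 2 ^ (n % 2)) := by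
        conv_lhs => rw [← Nat.div_add_mod n 2, pow_add, pow_mul, h2]
    _ ≤ 1 / 2 * ((2 : ℝ) ^ (n / 2) * 2) := by gcongr
    _ = _ := by ring

end ManyLocalMinima

theorem lemma1 :
    ∃ a : ℝ, 0 < a ∧ ∃ r : ℝ, 1 < r ∧ ∀ n : ℕ, 1 ≤ n →
      ∃ m p : ℕ, 1 ≤ m ∧ m ≤ n ∧ 1 ≤ p ∧ p ≤ n ∧ ∃ G : ODCSystem n m p, G.C.rank = p ∧
        ∀ w : ODCCost n m, w.weight.PosDef → w.D₀.PosDef →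
          (∃ T : Finset (Matrix (Fin m) (Fin p) ℝ),
            (∀ K ∈ T, G.IsConstrainedLocalMin w K) ∧ a * r ^ n ≤ (T.card : ℝ)) ∧
          ∀ h : Matrix (Fin m) (Fin p) ℝ → ℝ, G.IsPenalty h →
            ∃ c₀ : ℝ, 0 < c₀ ∧ ∀ c : ℝ, c₀ ≤ c →
              ∃ T : Finset (Matrix (Fin m) (Fin p) ℝ),
                (∀ K ∈ T, G.IsPenalizedLocalMin w h c K) ∧ a * r ^ n ≤ (T.card : ℝ) := by
  refine ⟨1 / 2, by norm_num, Real.sqrt 2, Real.one_lt_sqrt_two, fun n hn =>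
    ⟨n, n, hn, le_rfl, hn, le_rfl, pairSystem n, ?_, fun w hw hD₀ => ?_⟩⟩
  · change (1 : Matrix (Fin n) (Fin n) ℝ).rank = n
    rw [Matrix.rank_one, Fintype.card_fin]
  have hcard : ∀ T : Finset (Matrix (Fin n) (Fin n) ℝ),
      T.card = Fintype.card (Fin (n / 2) → Bool) → 1 / 2 * Real.sqrt 2 ^ n ≤ (T.card : ℝ) := by
    intro T hT
    rw [hT]
    simpa using sqrt_two_pow_le n
  obtain ⟨⟨T, hT, hTc⟩, hpen⟩ := (pairSystem n).exists_finset_localMin hw hD₀ (D := 1)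
    (Matrix.mul_one _) pairSystem.isOpen_piece (fun σ τ h => pairSystem.disjoint_piece h)
    (fun K => pairSystem.exists_mem_piece) pairSystem.exists_stabilizing_mem_piece
  refine ⟨⟨T, hT, hcard T hTc⟩, fun h hh => ?_⟩
  obtain ⟨c₀, hc₀, hc⟩ := hpen h hh
  refine ⟨c₀, hc₀, fun c hcc => ?_⟩
  obtain ⟨T, hT, hTc⟩ := hc c hcc
  exact ⟨T, hT, hcard T hTc⟩
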